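/- Let $\kappa$ be a regular uncountable cardinal and let $\lambda=(2^{<\kappa})^+$ be the successor cardinal of $2^{<\kappa}=\sup\{2^\mu:\mu<\kappa,\ \mu\text{ a cardinal}\}$. Let $\log\kappa$ be the least cardinal $\mu$ such that $2^\mu\ge\kappa$. Then for every $k<\omega$ and every ordinal $\xi<\log\kappa$, $$\lambda\to(\kappa+\xi)^2_k,$$ where $\kappa+\xi$ is the ordinal sum. That is, for every function $f:[\lambda]^2\to\{0,\dots,k-1\}$, where $[\lambda]^2$ is the set of two-element subsets of $\lambda$, there is a set $X\subseteq\lambda$ of order type $\kappa+\xi$ such that $f$ is constant on $[X]^2$. -/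

import Mathlib

universe u v

namespace ErdosRado

/-- `log κ`, the least cardinal `μ` such that `2 ^ μ ≥ κ`. -/
noncomputable def cardLog (κ : Cardinal.{u}) : Cardinal.{u} :=
  sInf {μ : Cardinal.{u} | κ ≤ 2 ^ μ}

/-- The infimum defining `log κ` is attained, and it is the least element. -/
theorem isLeast_cardLog (κ : Cardinal.{u}) :
    IsLeast {μ : Cardinal.{u} | κ ≤ 2 ^ μ} (cardLog κ) :=
  ⟨csInf_mem (s := {μ : Cardinal.{u} | κ ≤ 2 ^ μ}) ⟨κ, (Cardinal.cantor κ).le⟩,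
    fun _ h => csInf_le' h⟩

/-- `X` is homogeneous for the colouring `f : [A]² → C`: `f` is constant on `[X]²`.
Here `[A]²` is `Set.powersetCard A 2`, the type of finite subsets of `A` with exactly two
elements. -/
def IsHomogeneous {A : Type u} {C : Type v} (f : Set.powersetCard A 2 → C) (X : Set A) : Prop :=
  ∀ p q : Set.powersetCard A 2,
    ((p : Finset A) : Set A) ⊆ X → ((q : Finset A) : Set A) ⊆ X → f p = f q

/-- The ordinal partition relation `α → (β)²` with `C` as the set of colours: for every
colouring `f : [α]² → C` there is `X ⊆ α` of order type `β` that is homogeneous for `f`.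
The ordinal `α` is represented by the well-ordered type `α.ToType` of order type `α`. -/
def PartitionRel (α β : Ordinal.{u}) (C : Type v) : Prop :=
  ∀ f : Set.powersetCard α.ToType 2 → C, ∃ X : Set α.ToType,
    Ordinal.type (fun x y : X => x < y) = β ∧ IsHomogeneous f X

end ErdosRado

namespace ErdosRado

open Set Cardinal

/-! Non-small sets play the role of stationary sets of points of cofinality `κ`: everything is
non-small (`not_isSmall_univ`), and regressive maps into sets of size `< κ` can be pressed down
(`exists_not_isSmall_const`). Take a list `σ` of colours that is persistent but cannot be prolonged
by a new colour. Thinning gives a large `T` in which colours outside `σ` are negligible between any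
two points (`exists_forall_lt_not_isPositive`).

Let `T` be `σ`-positive at `δ ∈ T`. Above `δ`, `T` contains a rich set `Y` with `#Y ≤ #R ^ n < log
κ`, where `R` has order type `ξ`. There are thus fewer than `κ` colour patterns on `Y`, so by
`κ`-completeness the points of `T` up to `δ` sharing one pattern `g` remain `σ`-positive, and `g`
takes values in `σ`. Richness gives a homogeneous `ξ`-sequence in `Y` on which `g` is its own colour
`i ∈ σ`; positivity gives a `κ`-sequence of colour `i` below it. -/

/-- Well-founded recursion for a binary relation: if every partial sequence can be continued by a
term related to all of its terms, there is a sequence all of whose pairs are related. -/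
theorem exists_forall_lt_rel {K Z : Type*} [LinearOrder K] [WellFoundedLT K] (C : Z → Z → Prop)
    (H : ∀ (ν : K) (p : Iio ν → Z), ∃ z, ∀ η, C (p η) z) :
    ∃ x : K → Z, ∀ η ν, η < ν → C (x η) (x ν) := by
  classical
  let F : (ν : K) → ((η : K) → η < ν → Z) → Z := fun ν p => (H ν fun η => p η.1 η.2).choose
  refine ⟨(wellFounded_lt (α := K)).fix F, fun η ν h => ?_⟩
  rw [WellFounded.fix_eq _ F ν]
  exact (H ν fun η => (wellFounded_lt (α := K)).fix F η.1).choose_spec ⟨η, h⟩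

/-! ### Iterated ideals and the homogeneous sets found in positive sets. -/

section Positive

variable {L : Type u} [LinearOrder L] {C : Type v}

/-- The set of points above `a` that `f` does not distinguish from `ε` over `a`. -/
def agreeSet (f : L → L → C) (a : Set L) (ε : L) : Set L :=
  {δ | ∀ α ∈ a, α < δ ∧ f α δ = f α ε}

/-- Positivity of `X` with respect to the iterated ideal at `ε` with colours `σ`. -/
def IsPositive (κ : Cardinal.{u}) (f : L → L → C) : List C → L → Set L → Prop
  | [], δ, X => δ ∈ X
  | i :: σ, ε, X => ∀ a : Set L, a ⊆ Iio ε → #a < κ →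
      ∃ δ < ε, δ ∈ agreeSet f a ε ∧ IsPositive κ f σ δ {α ∈ X | α < ε ∧ f α ε = i}

variable {κ : Cardinal.{u}} {f : L → L → C}

theorem IsPositive.mono {σ : List C} {δ : L} {X Y : Set L} (h : IsPositive κ f σ δ X)
    (hXY : X ⊆ Y) : IsPositive κ f σ δ Y := by
  induction σ generalizing δ X Y with
  | nil => exact hXY h
  | cons i σ ih =>
    intro a ha hκ
    obtain ⟨γ, hγ, hγa, hp⟩ := h a ha hκ
    exact ⟨γ, hγ, hγa, ih hp fun x hx => ⟨hXY hx.1, hx.2⟩⟩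

theorem IsPositive.inter_Iic {σ : List C} {δ : L} {X : Set L} (h : IsPositive κ f σ δ X) :
    IsPositive κ f σ δ (X ∩ Iic δ) := by
  cases σ with
  | nil => exact ⟨h, le_rfl⟩
  | cons i σ =>
    intro a ha hκ
    obtain ⟨γ, hγ, hγa, hp⟩ := h a ha hκ
    exact ⟨γ, hγ, hγa, hp.mono fun x hx => ⟨⟨hx.1, hx.2.1.le⟩, hx.2⟩⟩

theorem IsPositive.nonempty (h0 : 0 < κ) {σ : List C} {δ : L} {X : Set L}
    (h : IsPositive κ f σ δ X) : X.Nonempty := by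
  induction σ generalizing δ X with
  | nil => exact ⟨δ, h⟩
  | cons i σ ih =>
    obtain ⟨γ, -, -, hp⟩ := h ∅ (empty_subset _) (by simpa using h0)
    exact (ih hp).mono fun x hx => hx.1

/-- Agreement over `a` composes along the descent from `δ` to the reflecting points, so adding `a`
to each challenge costs nothing. -/
theorem IsPositive.inter_agreeSet (hκ : ℵ₀ ≤ κ) {σ : List C} {δ : L} {X a : Set L}
    (h : IsPositive κ f σ δ X) (ha : a ⊆ Iio δ) (hac : #a < κ) :
    IsPositive κ f σ δ (X ∩ agreeSet f a δ) := by
  induction σ generalizing δ X a with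
  | nil => exact ⟨h, fun α hα => ⟨ha hα, rfl⟩⟩
  | cons i σ ih =>
    intro b hb hbc
    obtain ⟨γ, hγ, hγa, hp⟩ := h (a ∪ b) (union_subset ha hb)
      ((mk_union_le a b).trans_lt (add_lt_of_lt hκ hac hbc))
    refine ⟨γ, hγ, fun α hα => hγa α (Or.inr hα), ?_⟩
    refine (ih hp (a := a) (fun α hα => (hγa α (Or.inl hα)).1) hac).mono ?_
    rintro x ⟨hx, hxa⟩
    exact ⟨⟨hx.1, fun α hα => ⟨(hxa α hα).1, (hxa α hα).2.trans (hγa α (Or.inl hα)).2⟩⟩, hx.2⟩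

/-- Completeness of the ideal: by regularity, the union of the challenges defeating the individual
pieces is again a legal challenge. -/
theorem IsPositive.exists_of_iUnion (hκ : κ.IsRegular) {ι : Type u} (hι : #ι < κ) {σ : List C}
    {δ : L} {X : ι → Set L} (h : IsPositive κ f σ δ (⋃ ν, X ν)) :
    ∃ ν, IsPositive κ f σ δ (X ν) := by
  induction σ generalizing δ X with
  | nil => exact mem_iUnion.1 h
  | cons i σ ih =>
    by_contra! hcon
    simp only [IsPositive, not_forall] at hcon
    choose a ha hac hbad using hcon
    obtain ⟨γ, hγ, hγa, hp⟩ := h (⋃ ν, a ν) (iUnion_subset ha)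
      ((card_iUnion_lt_iff_forall_of_isRegular hκ hι).2 hac)
    have hp' : IsPositive κ f σ γ (⋃ ν, {α ∈ X ν | α < δ ∧ f α δ = i}) := by
      refine hp.mono ?_
      rintro x ⟨hx, hx'⟩
      obtain ⟨ν, hν⟩ := mem_iUnion.1 hx
      exact mem_iUnion.2 ⟨ν, hν, hx'⟩
    obtain ⟨ν, hν⟩ := ih hp'
    exact hbad ν ⟨γ, hγ, fun α hα => hγa α (mem_iUnion.2 ⟨ν, hα⟩), hν⟩

/-- A sequence is increasing and homogeneous in the colour `i`. -/
def IsHomogeneousSeq (f : L → L → C) (i : C) {K : Type*} [LT K] (x : K → L) : Prop :=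
  ∀ η ν, η < ν → x η < x ν ∧ f (x η) (x ν) = i

theorem IsPositive.exists_homogeneousSeq (hκ : ℵ₀ ≤ κ) {σ : List C} {ε : L} {X : Set L}
    (h : IsPositive κ f σ ε X) {i : C} (hi : i ∈ σ) {K : Type u} [LinearOrder K]
    [WellFoundedLT K] (hK : ∀ ν : K, #(Iio ν) < κ) :
    ∃ x : K → L, (∀ ν, x ν ∈ X) ∧ IsHomogeneousSeq f i x := by
  induction σ generalizing ε X with
  | nil => simp at hi
  | cons j σ ih =>
    rcases eq_or_ne i j with rfl | hij
    · obtain ⟨x, hx⟩ := exists_forall_lt_rel (K := K)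
        (Z := {α // α ∈ X ∧ α < ε ∧ f α ε = i}) (fun α β => α.1 < β.1 ∧ f α.1 β.1 = i) (by
          intro ν p
          have hsub : range (fun η => (p η).1) ⊆ Iio ε := by
            rintro _ ⟨η, rfl⟩; exact (p η).2.2.1
          have hcard : #(range fun η => (p η).1) < κ := mk_range_le.trans_lt (hK ν)
          -- The next term `z` agrees with `δ`, and `δ` with `ε`, over the earlier terms, which all
          -- have colour `i` with `ε`.
          obtain ⟨δ, hδ, hδa, hp⟩ := h _ hsub hcard
          obtain ⟨z, hz, hza⟩ := (hp.inter_agreeSet hκ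
            (fun α hα => (hδa α hα).1) hcard).nonempty (aleph0_pos.trans_le hκ)
          refine ⟨⟨z, hz⟩, fun η => ?_⟩
          have h1 := hza _ ⟨η, rfl⟩
          have h2 := hδa _ ⟨η, rfl⟩
          exact ⟨h1.1, h1.2.trans (h2.2.trans (p η).2.2.2)⟩)
      exact ⟨fun ν => (x ν).1, fun ν => (x ν).2.1, hx⟩
    · obtain ⟨γ, -, -, hp⟩ := h ∅ (empty_subset _) (by simpa using aleph0_pos.trans_le hκ)
      obtain ⟨x, hx, hh⟩ := ih hp ((List.mem_cons.1 hi).resolve_left hij)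
      exact ⟨x, fun ν => (hx ν).1, hh⟩

/-- Every colouring of `Y` by members of `σ` has a homogeneous sequence indexed by `R` whose
points have the colour of its pairs. -/
def IsRich (f : L → L → C) (σ : List C) (R : Type u) [LT R] (Y : Set L) : Prop :=
  ∀ g : L → C, (∀ y ∈ Y, g y ∈ σ) →
    ∃ i ∈ σ, ∃ y : R → L, (∀ ν, y ν ∈ Y ∧ g (y ν) = i) ∧ IsHomogeneousSeq f i y

/-- Stack an `R`-sequence of sets rich for the tail, with head colour `i` between different blocks.
Either `g` avoids `i` on some block, which then suffices, or one point with `g = i` can be picked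
from every block. -/
theorem IsPositive.exists_isRich (hκ : ℵ₀ ≤ κ) {R : Type u} [LinearOrder R] [WellFoundedLT R]
    (hR : ∀ n : ℕ, #R ^ n < κ) {σ : List C} {ε : L} {X : Set L} (h : IsPositive κ f σ ε X) :
    ∃ Y ⊆ X, #Y ≤ #R ^ σ.length ∧ IsRich f σ R Y := by
  induction σ generalizing ε X with
  | nil =>
    refine ⟨{ε}, singleton_subset_iff.2 h, by simp, fun g hg => ?_⟩
    simpa using hg ε rfl
  | cons i σ ih =>
    have hbound : ∀ (s : Set R) (p : s → Set L), (∀ ν, #(p ν) ≤ #R ^ σ.length) →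
        #(⋃ ν, p ν) ≤ #R ^ (σ.length + 1) := by
      intro s p hp
      calc #(⋃ ν, p ν) ≤ sum fun ν => #(p ν) := mk_iUnion_le_sum_mk
        _ ≤ sum fun _ : s => #R ^ σ.length := sum_le_sum _ _ hp
        _ = #s * #R ^ σ.length := by simp
        _ ≤ #R * #R ^ σ.length := by gcongr; exact mk_set_le s
        _ = _ := (pow_succ' _ _).symm
    obtain ⟨x, hx⟩ := exists_forall_lt_rel (K := R)
      (Z := {Y : Set L // Y ⊆ {α ∈ X | α < ε ∧ f α ε = i} ∧ #Y ≤ #R ^ σ.length ∧ IsRich f σ R Y})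
      (fun A B => ∀ α ∈ A.1, ∀ β ∈ B.1, α < β ∧ f α β = i) (by
        intro ν p
        have hsub : (⋃ η, (p η).1) ⊆ Iio ε := iUnion_subset fun η α hα => ((p η).2.1 hα).2.1
        have hcard : #(⋃ η, (p η).1) < κ :=
          (hbound (Iio ν) (fun η => (p η).1) fun η => (p η).2.2.1).trans_lt (hR _)
        obtain ⟨δ, hδ, hδa, hp⟩ := h _ hsub hcard
        obtain ⟨Y, hY, hYc, hYr⟩ := ih (hp.inter_agreeSet hκ (fun α hα => (hδa α hα).1) hcard)
        refine ⟨⟨Y, fun y hy => (hY hy).1, hYc, hYr⟩, fun η α hα β hβ => ?_⟩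
        have hα' : α ∈ ⋃ η, (p η).1 := mem_iUnion.2 ⟨η, hα⟩
        have h1 := (hY hβ).2 α hα'
        exact ⟨h1.1, h1.2.trans ((hδa α hα').2.trans ((p η).2.1 hα).2.2)⟩)
    refine ⟨⋃ ν, (x ν).1, iUnion_subset fun ν α hα => ((x ν).2.1 hα).1, ?_, fun g hg => ?_⟩
    · have := hbound univ (fun ν => (x ν.1).1) fun ν => (x ν.1).2.2.1
      simpa [iUnion_subtype] using this
    · by_cases hc : ∃ ν, ∀ y ∈ (x ν).1, g y ∈ σ
      · obtain ⟨ν, hν⟩ := hc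
        obtain ⟨j, hj, y, hy, hyh⟩ := (x ν).2.2.2 g hν
        exact ⟨j, List.mem_cons_of_mem _ hj, y,
          fun η => ⟨mem_iUnion.2 ⟨ν, (hy η).1⟩, (hy η).2⟩, hyh⟩
      · push Not at hc
        choose y hy hyσ using hc
        refine ⟨i, List.mem_cons_self, y, fun ν => ⟨mem_iUnion.2 ⟨ν, hy ν⟩, ?_⟩,
          fun η ν hην => hx η ν hην _ (hy η) _ (hy ν)⟩
        exact (List.mem_cons.1 (hg _ (mem_iUnion.2 ⟨ν, hy ν⟩))).resolve_right (hyσ ν)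

end Positive

/-! ### A pressing-down lemma for the ideal of small sets. -/

section Small

variable {L : Type u} [LinearOrder L] {W : Type u}

/-- `X` is the union of the bounded fibres of a regressive map into the subsets of `W` of
cardinality less than `κ`, where `r` ranks the points of `W`. -/
def IsSmall (κ : Cardinal.{u}) (r : W → L) (X : Set L) : Prop :=
  ∃ G : L → Set W, (∀ δ ∈ X, #(G δ) < κ ∧ ∀ w ∈ G δ, r w < δ) ∧
    ∀ s, BddAbove {δ ∈ X | G δ = s}

variable {κ μ : Cardinal.{u}} {r : W → L}

theorem IsSmall.mono {X Y : Set L} (h : IsSmall κ r Y) (hXY : X ⊆ Y) : IsSmall κ r X := by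
  obtain ⟨G, hG, hb⟩ := h
  exact ⟨G, fun δ hδ => hG δ (hXY hδ), fun s =>
    (hb s).mono (fun _ hδ => ⟨hXY hδ.1, hδ.2⟩ : {δ ∈ X | G δ = s} ⊆ {δ ∈ Y | G δ = s})⟩

theorem IsSmall.of_diff_Iic (h0 : 0 < κ) {X : Set L} {δ : L} (h : IsSmall κ r (X \ Iic δ)) :
    IsSmall κ r X := by
  classical
  obtain ⟨G, hG, hb⟩ := h
  refine ⟨fun x => if x ≤ δ then ∅ else G x, fun x hx => ?_, fun s => ?_⟩
  · by_cases hxδ : x ≤ δ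
    · simpa [hxδ] using h0
    · simpa [hxδ] using hG x ⟨hx, hxδ⟩
  · refine ((hb s).union (bddAbove_Iic (a := δ))).mono ?_
    rintro x ⟨hx, hxs⟩
    by_cases hxδ : x ≤ δ
    · exact Or.inr hxδ
    · exact Or.inl ⟨⟨hx, hxδ⟩, by simpa [hxδ] using hxs⟩

theorem bddAbove_iUnion_of_mk_le (hb : ∀ s : Set L, #s ≤ μ → BddAbove s) {ι : Type u}
    (hι : #ι ≤ μ) {X : ι → Set L} (hX : ∀ i, BddAbove (X i)) : BddAbove (⋃ i, X i) := by
  choose b hb' using hX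
  obtain ⟨c, hc⟩ := hb (range b) (mk_range_le.trans hι)
  refine ⟨c, fun x hx => ?_⟩
  obtain ⟨i, hi⟩ := mem_iUnion.1 hx
  exact (hb' i hi).trans (hc ⟨i, rfl⟩)

/-- A regressive map is constant on a non-small subset of any non-small set. -/
theorem exists_not_isSmall_const (hκ : ℵ₀ ≤ κ) (hb : ∀ s : Set L, #s ≤ μ → BddAbove s)
    (hμ : ∀ c < κ, 2 ^ c ≤ μ) {S : Set L} (hS : ¬ IsSmall κ r S) {G : L → Set W}
    (hG : ∀ δ ∈ S, #(G δ) < κ ∧ ∀ w ∈ G δ, r w < δ) :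
    ∃ s, ¬ IsSmall κ r {δ ∈ S | G δ = s} := by
  by_contra! hcon
  choose A hA hAb using hcon
  refine hS ⟨fun δ => A (G δ) δ ∪ G δ, fun δ hδ => ?_, fun s => ?_⟩
  · have h1 := hA (G δ) δ ⟨hδ, rfl⟩
    have h2 := hG δ hδ
    refine ⟨(mk_union_le _ _).trans_lt (add_lt_of_lt hκ h1.1 h2.1), ?_⟩
    rintro w (hw | hw)
    exacts [h1.2 w hw, h2.2 w hw]
  -- On the fibre over `s` both components are subsets of `s`, so it splits into at most `2 ^ (#s +
  -- #s) ≤ μ` bounded pieces. If `#s ≥ κ` the fibre is empty.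
  · by_cases hs : #s < κ
    · have hcard : #(Set s × Set s) ≤ μ := by
        simpa [power_add] using hμ (#s + #s) (add_lt_of_lt hκ hs hs)
      refine (bddAbove_iUnion_of_mk_le hb hcard
        (X := fun p => {δ ∈ {δ ∈ S | G δ = (↑) '' p.2} | A ((↑) '' p.2) δ = (↑) '' p.1})
        fun p => hAb _ _).mono ?_
      rintro δ ⟨hδ, hδs⟩
      have h1 : A (G δ) δ ⊆ s := hδs ▸ subset_union_left
      have h2 : G δ ⊆ s := hδs ▸ subset_union_right
      refine mem_iUnion.2 ⟨((↑) ⁻¹' A (G δ) δ, (↑) ⁻¹' G δ), ?_⟩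
      have e1 : ((↑) '' ((↑) ⁻¹' A (G δ) δ : Set s) : Set W) = A (G δ) δ := by
        simpa using h1
      have e2 : ((↑) '' ((↑) ⁻¹' G δ : Set s) : Set W) = G δ := by
        simpa using h2
      exact ⟨⟨hδ, e2.symm⟩, by rw [e1, e2]⟩
    · refine (hb ∅ (by simp)).mono ?_
      rintro δ ⟨hδ, rfl⟩
      exact hs ((mk_union_le _ _).trans_lt
        (add_lt_of_lt hκ (hA (G δ) δ ⟨hδ, rfl⟩).1 (hG δ hδ).1))

theorem exists_forall_lt_of_mk_lt (hκ : κ.IsRegular) (s : Set κ.ord.ToType) (hs : #s < κ) :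
    ∃ b, ∀ x ∈ s, x < b := by
  by_contra! hcon
  have h : IsCofinal s := hcon
  have := Order.cof_le h
  rw [Ordinal.cof_toType, hκ.cof_ord] at this
  exact this.not_gt hs

theorem mk_Iio_ord_toType_lt (ν : κ.ord.ToType) : #(Iio ν) < κ := by
  simpa using mk_Iio_lt ν (by simp)

/-- If `h ζ` bounds all `δ` whose value lies below `ζ`, let `δ` be the supremum of a `κ`-sequence
closed under `h`. By regularity `G δ` lies below some term, which forces `δ` below a later term. -/
theorem not_isSmall_univ [WellFoundedLT L] (hκ : κ.IsRegular) (hκμ : κ ≤ μ)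
    (hb : ∀ s : Set L, #s ≤ μ → ∃ b, ∀ x ∈ s, x < b)
    (hW : ∀ ζ, #{s : Set W // #s < κ ∧ ∀ w ∈ s, r w < ζ} ≤ μ) : ¬ IsSmall κ r Set.univ := by
  rintro ⟨G, hG, hGb⟩
  have hb' : ∀ s : Set L, #s ≤ μ → BddAbove s := fun s hs =>
    (hb s hs).imp fun b h x hx => (h x hx).le
  have hh : ∀ ζ, ∃ b, ∀ δ, (∀ w ∈ G δ, r w < ζ) → δ ≤ b := by
    intro ζ
    obtain ⟨b, hbd⟩ := bddAbove_iUnion_of_mk_le hb' (hW ζ)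
      (X := fun s => {δ ∈ Set.univ | G δ = s.1}) fun s => hGb s.1
    exact ⟨b, fun δ hδ => hbd (mem_iUnion.2
      ⟨⟨G δ, (hG δ trivial).1, hδ⟩, trivial, rfl⟩)⟩
  choose h hh using hh
  obtain ⟨d, hd⟩ := exists_forall_lt_rel (K := κ.ord.ToType) (Z := L)
    (fun x y => x < y ∧ h x < y) (by
      intro ν p
      have hp : ∀ q : Iio ν → L, #(range q) ≤ μ := fun q =>
        mk_range_le.trans ((mk_Iio_ord_toType_lt ν).le.trans hκμ)
      obtain ⟨b, hb1⟩ := hb _ (hp p)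
      obtain ⟨c, hc⟩ := hb _ (hp fun η => h (p η))
      exact ⟨max b c, fun η => ⟨lt_max_of_lt_left (hb1 _ ⟨η, rfl⟩),
        lt_max_of_lt_right (hc _ ⟨η, rfl⟩)⟩⟩)
  obtain ⟨δ, hδ, hmin⟩ := WellFounded.has_min (wellFounded_lt (α := L))
    {b | ∀ ν, d ν < b} (by
      obtain ⟨b, hb1⟩ := hb (range d) (mk_range_le.trans (by simpa using hκμ))
      exact ⟨b, fun ν => hb1 _ ⟨ν, rfl⟩⟩)
  have hex : ∀ w : G δ, ∃ ν, r w ≤ d ν := by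
    intro w
    by_contra! hcon
    exact hmin _ hcon ((hG δ trivial).2 w w.2)
  choose n hn using hex
  obtain ⟨ν, hν⟩ := exists_forall_lt_of_mk_lt hκ (range n)
    (mk_range_le.trans_lt (hG δ trivial).1)
  obtain ⟨ν', hν'⟩ := exists_forall_lt_of_mk_lt hκ {ν}
    (by simpa using one_lt_aleph0.trans_le hκ.aleph0_le)
  have h1 : δ ≤ h (d ν) := hh _ _ fun w hw =>
    (hn ⟨w, hw⟩).trans_lt (hd _ _ (hν _ ⟨⟨w, hw⟩, rfl⟩)).1
  exact (h1.trans_lt ((hd ν ν' (hν' ν rfl)).2.trans (hδ ν'))).false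

end Small

/-! ### Counting subsets of size less than `κ`. -/

section Arithmetic

variable {κ : Cardinal.{u}}

theorem le_two_powerlt (κ : Cardinal.{u}) : κ ≤ 2 ^< κ :=
  le_of_forall_lt fun c hc => (cantor c).trans_le (le_powerlt 2 hc)

theorem two_powerlt_le_mk_bounded (hκ : κ.IsRegular) :
    2 ^< κ ≤ #{b : Set κ.ord.ToType // ∃ β, b ⊆ Iio β} := by
  refine powerlt_le.2 fun ν hν => ?_
  obtain ⟨s, rfl⟩ := (le_mk_iff_exists_set (α := κ.ord.ToType)).1 (by simpa using hν.le)
  obtain ⟨β, hβ⟩ := exists_forall_lt_of_mk_lt hκ s hν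
  rw [← mk_set]
  refine mk_le_of_injective (f := fun t : Set s => ⟨(↑) '' t, β, ?_⟩) ?_
  · rintro _ ⟨x, -, rfl⟩
    exact hβ x x.2
  · intro t t' h
    exact Subtype.val_injective.image_injective (congrArg Subtype.val h)

/-- A set of size at most `2 ^< κ` has at most `2 ^< κ` subsets of size less than `κ`. -/
theorem mk_subsets_lt_le (hκ : κ.IsRegular) {A : Type u} (hA : #A ≤ 2 ^< κ) :
    #{s : Set A // #s < κ} ≤ 2 ^< κ := by
  obtain ⟨e⟩ := hA.trans (two_powerlt_le_mk_bounded hκ)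
  -- Points of `A` are bounded subsets of `κ` via `e`; fewer than `κ` of them fit, below a single
  -- `γ`, as the selected rows of a 0-1 matrix on `γ × γ`.
  let Code := Σ γ : κ.ord.ToType, Set (Iio γ) × Set (Iio γ × Iio γ)
  let Φ : Code → Set A := fun c =>
    {a | ∃ η ∈ c.2.1, (e a).1 = (↑) '' {x : Iio c.1 | (η, x) ∈ c.2.2}}
  have hsurj : {s : Set A | #s < κ} ⊆ range Φ := by
    intro s hs
    obtain ⟨j⟩ : #s ≤ #κ.ord.ToType := by simpa using hs.le
    obtain ⟨ν, hν⟩ := exists_forall_lt_of_mk_lt hκ (range j) (mk_range_le.trans_lt hs)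
    choose b hb using fun a : s => (e a).2
    obtain ⟨β, hβ⟩ := exists_forall_lt_of_mk_lt hκ (range b) (mk_range_le.trans_lt hs)
    have hj : ∀ a, j a < max ν β := fun a => lt_max_of_lt_left (hν _ ⟨a, rfl⟩)
    refine ⟨⟨max ν β, range fun a => ⟨j a, hj a⟩,
      {p | ∃ a, j a = p.1.1 ∧ p.2.1 ∈ (e a).1}⟩, ?_⟩
    have key : ∀ a : s, (e a).1 = ((↑) '' {x : Iio (max ν β) |
        ((⟨j a, hj a⟩ : Iio (max ν β)), x) ∈
          {p : Iio (max ν β) × Iio (max ν β) | ∃ a, j a = p.1.1 ∧ p.2.1 ∈ (e a).1}} :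
            Set κ.ord.ToType) := by
      intro a
      ext x
      constructor
      · intro hx
        have hxβ : x < max ν β :=
          lt_max_of_lt_right (lt_trans (hb a hx) (hβ _ ⟨a, rfl⟩))
        exact ⟨⟨x, hxβ⟩, ⟨a, rfl, hx⟩, rfl⟩
      · rintro ⟨y, ⟨a', ha', hy⟩, rfl⟩
        rwa [j.injective ha'] at hy
    ext a
    constructor
    · rintro ⟨_, ⟨a', rfl⟩, h⟩
      have := e.injective (Subtype.ext (h.trans (key a').symm))
      exact this ▸ a'.2
    · intro ha
      exact ⟨_, ⟨⟨a, ha⟩, rfl⟩, key ⟨a, ha⟩⟩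
  have hinf : ℵ₀ ≤ 2 ^< κ := hκ.aleph0_le.trans (le_two_powerlt κ)
  calc #{s : Set A // #s < κ} ≤ #(range Φ) := mk_le_mk_of_subset hsurj
    _ ≤ #Code := mk_range_le
    _ = sum fun γ : κ.ord.ToType => #(Set (Iio γ) × Set (Iio γ × Iio γ)) := mk_sigma _
    _ ≤ sum fun _ : κ.ord.ToType => 2 ^< κ := by
      refine sum_le_sum _ _ fun γ => ?_
      have hγ := mk_Iio_ord_toType_lt γ
      have := le_powerlt 2 (add_lt_of_lt hκ.aleph0_le hγ (mul_lt_of_lt hκ.aleph0_le hγ hγ))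
      simpa [power_add] using this
    _ = κ * 2 ^< κ := by simp
    _ ≤ 2 ^< κ * 2 ^< κ := by gcongr; exact le_two_powerlt κ
    _ = 2 ^< κ := mul_eq_self hinf

theorem mk_subsets_of_lt_le (hκ : κ.IsRegular) {W : Type u} {t : Set W} (ht : #t ≤ 2 ^< κ) :
    #{s : Set W // #s < κ ∧ s ⊆ t} ≤ 2 ^< κ := by
  refine le_trans (mk_le_of_injective (f := fun s : {s : Set W // #s < κ ∧ s ⊆ t} =>
    (⟨((↑) : t → W) ⁻¹' s.1, ?_⟩ : {s : Set t // #s < κ})) ?_) (mk_subsets_lt_le hκ ht)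
  · exact (mk_preimage_of_injective _ _ Subtype.val_injective).trans_lt s.2.1
  · intro s s' h
    have h' : ((↑) : t → W) ⁻¹' s.1 = ((↑) : t → W) ⁻¹' s'.1 := congrArg Subtype.val h
    ext x
    constructor <;> intro hx
    · exact (Set.ext_iff.1 h' ⟨x, s.2.2 hx⟩).1 hx
    · exact (Set.ext_iff.1 h' ⟨x, s'.2.2 hx⟩).2 hx

end Arithmetic

/-! ### Maximal persistent colour lists and the combinatorial core. -/

section Core

variable {L : Type u} [LinearOrder L] {C : Type} {κ : Cardinal.{u}} {f : L → L → C}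

/-- Every large subset of some large set is `σ`-positive at one of its points. -/
def IsPersistent (κ : Cardinal.{u}) (f : L → L → C) (σ : List C) : Prop :=
  ∃ S : Set L, ¬ IsSmall κ (Prod.fst : L × C → L) S ∧
    ∀ T ⊆ S, ¬ IsSmall κ (Prod.fst : L × C → L) T → ∃ ε ∈ T, IsPositive κ f σ ε T

theorem exists_maximal_isPersistent [Finite C] (h : IsPersistent κ f []) :
    ∃ σ, IsPersistent κ f σ ∧ ∀ j ∉ σ, ¬ IsPersistent κ f (j :: σ) := by
  by_contra! hcon
  have hn : ∀ n, ∃ σ : List C, σ.Nodup ∧ σ.length = n ∧ IsPersistent κ f σ := by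
    intro n
    induction n with
    | zero => exact ⟨[], List.nodup_nil, rfl, h⟩
    | succ n ih =>
      obtain ⟨σ, hnd, rfl, hσ⟩ := ih
      obtain ⟨j, hj, hp⟩ := hcon σ hσ
      exact ⟨j :: σ, List.nodup_cons.2 ⟨hj, hnd⟩, rfl, hp⟩
  have := Fintype.ofFinite C
  obtain ⟨σ, hnd, hlen, -⟩ := hn (Fintype.card C + 1)
  have := hnd.length_le_card
  omega

theorem exists_forall_not_isPositive {S : Set L}
    (hS : ¬ IsSmall κ (Prod.fst : L × C → L) S) {σ : List C} (t : Finset C)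
    (ht : ∀ j ∈ t, ¬ IsPersistent κ f (j :: σ)) :
    ∃ T ⊆ S, ¬ IsSmall κ (Prod.fst : L × C → L) T ∧
      ∀ j ∈ t, ∀ ε ∈ T, ¬ IsPositive κ f (j :: σ) ε T := by
  classical
  induction t using Finset.induction_on with
  | empty => exact ⟨S, subset_rfl, hS, by simp⟩
  | insert j t _ ih =>
    obtain ⟨T, hTS, hT, hTp⟩ := ih fun i hi => ht i (Finset.mem_insert_of_mem hi)
    have hj := ht j (Finset.mem_insert_self _ _)
    simp only [IsPersistent, not_exists, not_and, not_forall] at hj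
    obtain ⟨T', hT'T, hT', hp⟩ := hj T hT
    refine ⟨T', hT'T.trans hTS, hT', fun i hi ε hε hpos => ?_⟩
    rcases Finset.mem_insert.1 hi with rfl | hi
    · exact hp ε hε hpos
    · exact hTp i hi ε (hT'T hε) (hpos.mono hT'T)

/-- A large set thins out to a large set over which the colours outside a maximal persistent
`σ` are nowhere positive. -/
theorem exists_forall_lt_not_isPositive [Finite C] {μ : Cardinal.{u}} (hκ : ℵ₀ ≤ κ)
    (hb : ∀ s : Set L, #s ≤ μ → BddAbove s) (hμ : ∀ c < κ, 2 ^ c ≤ μ) {S : Set L}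
    (hS : ¬ IsSmall κ (Prod.fst : L × C → L) S) {σ : List C}
    (hσ : ∀ j ∉ σ, ¬ IsPersistent κ f (j :: σ)) :
    ∃ T ⊆ S, ¬ IsSmall κ (Prod.fst : L × C → L) T ∧ ∀ j ∉ σ, ∀ δ ∈ T, ∀ ε ∈ T, δ < ε →
      ¬ IsPositive κ f σ δ {α ∈ T | α < ε ∧ f α ε = j} := by
  classical
  have := Fintype.ofFinite C
  obtain ⟨T, hTS, hT, hTp⟩ := exists_forall_not_isPositive hS (σ := σ) (f := f)
    (Finset.univ.filter (· ∉ σ)) fun j hj => hσ j (by simpa using hj)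
  have hw : ∀ j, ∀ ε, ∃ a : Set L, (a ⊆ Iio ε ∧ #a < κ) ∧ (j ∉ σ → ε ∈ T → ∀ δ < ε,
      δ ∈ agreeSet f a ε → ¬ IsPositive κ f σ δ {α ∈ T | α < ε ∧ f α ε = j}) := by
    intro j ε
    by_cases h : j ∉ σ ∧ ε ∈ T
    · have := hTp j (by simpa using h.1) ε h.2
      simp only [IsPositive, not_forall] at this
      obtain ⟨a, ha, hac, hbad⟩ := this
      exact ⟨a, ⟨ha, hac⟩, fun _ _ δ hδ hδa hp => hbad ⟨δ, hδ, hδa, hp⟩⟩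
    · exact ⟨∅, ⟨empty_subset _, by simpa using aleph0_pos.trans_le hκ⟩,
        fun h1 h2 => (h ⟨h1, h2⟩).elim⟩
  choose a ha hbad using hw
  -- `G ε` records the challenges at `ε` with their colours, so `G δ = G ε` makes `δ` agree with `ε`
  -- over each `a j ε`.
  let G : L → Set (L × C) := fun ε => ⋃ j, (fun α => (α, f α ε)) '' a j ε
  have hG : ∀ ε ∈ T, #(G ε) < κ ∧ ∀ w ∈ G ε, w.1 < ε := by
    intro ε _
    constructor
    · have hU : ∀ t : Finset C, #(⋃ j ∈ t, (fun α => (α, f α ε)) '' a j ε : Set (L × C)) < κ := by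
        intro t
        induction t using Finset.induction_on with
        | empty => simpa using aleph0_pos.trans_le hκ
        | insert j t _ ih =>
          rw [Finset.set_biUnion_insert]
          exact (mk_union_le _ _).trans_lt
            (add_lt_of_lt hκ (mk_image_le.trans_lt (ha j ε).2) ih)
      simpa [G] using hU Finset.univ
    · intro w hw
      obtain ⟨j, α, hα, rfl⟩ := mem_iUnion.1 hw
      exact (ha j ε).1 hα
  obtain ⟨s, hs⟩ := exists_not_isSmall_const hκ hb hμ hT hG
  refine ⟨_, (sep_subset _ _).trans hTS, hs, fun j hj δ hδ ε hε hlt hp => ?_⟩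
  refine hbad j ε hj hε.1 δ hlt (fun α hα => ?_) (hp.mono fun x hx => ⟨hx.1.1, hx.2⟩)
  have hmem : (α, f α ε) ∈ G δ := by
    rw [hδ.2, ← hε.2]
    exact mem_iUnion.2 ⟨j, α, hα, rfl⟩
  obtain ⟨i, β, hβ, hβα⟩ := mem_iUnion.1 hmem
  simp only [Prod.mk.injEq] at hβα
  obtain ⟨rfl, hc⟩ := hβα
  exact ⟨(ha i δ).1 hβ, hc⟩

/-- The combinatorial core: `f` has a homogeneous `K`-sequence followed by a homogeneous
`R`-sequence, with the same colour within and between them. -/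
theorem exists_homogeneousSeq_pair [WellFoundedLT L] [Finite C] (hκ : κ.IsRegular)
    (hb : ∀ s : Set L, #s ≤ 2 ^< κ → ∃ b, ∀ x ∈ s, x < b) (hI : ∀ b : L, #(Iio b) ≤ 2 ^< κ)
    {K R : Type u} [LinearOrder K] [WellFoundedLT K] [LinearOrder R] [WellFoundedLT R]
    (hK : ∀ ν : K, #(Iio ν) < κ) (hR : ∀ n : ℕ, #R ^ n < κ)
    (hRC : ∀ (n : ℕ) (Y : Set L), #Y ≤ #R ^ n → #(Y → C) < κ) (f : L → L → C) :
    ∃ (i : C) (x : K → L) (y : R → L), IsHomogeneousSeq f i x ∧ IsHomogeneousSeq f i y ∧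
      ∀ ν η, x ν < y η ∧ f (x ν) (y η) = i := by
  have hinf : ℵ₀ ≤ 2 ^< κ := hκ.aleph0_le.trans (le_two_powerlt κ)
  have h0 : 0 < κ := hκ.pos
  have hb' : ∀ s : Set L, #s ≤ 2 ^< κ → BddAbove s := fun s hs =>
    (hb s hs).imp fun b h x hx => (h x hx).le
  have huniv : ¬ IsSmall κ (Prod.fst : L × C → L) Set.univ := by
    refine not_isSmall_univ hκ (le_two_powerlt κ) hb fun ζ => ?_
    refine mk_subsets_of_lt_le hκ (t := {w : L × C | w.1 < ζ}) ?_
    refine (mk_le_of_injective (f := fun w : {w : L × C | w.1 < ζ} =>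
      ((⟨w.1.1, w.2⟩, w.1.2) : Iio ζ × C)) fun w w' h => ?_).trans ?_
    · simp only [Prod.mk.injEq] at h
      exact Subtype.ext (Prod.ext (congrArg Subtype.val h.1) h.2)
    simp only [mk_prod, lift_uzero]
    refine mul_le_of_le hinf (hI ζ) (le_trans ?_ hinf)
    simp
  have hnon : ∀ {T : Set L}, ¬ IsSmall κ (Prod.fst : L × C → L) T → T.Nonempty := by
    intro T hT
    by_contra hcon
    rw [not_nonempty_iff_eq_empty] at hcon
    subst hcon
    exact hT ⟨fun _ => ∅, by simp, fun s => by simpa using hb' ∅ (by simp)⟩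
  obtain ⟨σ, ⟨S, hS, hSp⟩, hσ⟩ := exists_maximal_isPersistent (κ := κ) (f := f)
    ⟨Set.univ, huniv, fun T _ hT => (hnon hT).imp fun x hx => ⟨hx, hx⟩⟩
  obtain ⟨T, hTS, hT, hTn⟩ := exists_forall_lt_not_isPositive hκ.aleph0_le hb'
    (fun c hc => le_powerlt 2 hc) hS hσ
  obtain ⟨δ, hδT, hδ⟩ := hSp T hTS hT
  have hT' : ¬ IsSmall κ (Prod.fst : L × C → L) (T \ Iic δ) := fun h => hT (h.of_diff_Iic h0)
  obtain ⟨ε, -, hε⟩ := hSp _ (sdiff_subset.trans hTS) hT'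
  obtain ⟨Y, hY, hYc, hYr⟩ := hε.exists_isRich hκ.aleph0_le hR
  have hcov : IsPositive κ f σ δ (⋃ g : Y → C, {α ∈ T ∩ Iic δ | ∀ y : Y, f α y = g y}) :=
    hδ.inter_Iic.mono fun α hα => mem_iUnion.2 ⟨fun y => f α y, hα, fun _ => rfl⟩
  obtain ⟨g, hg⟩ := hcov.exists_of_iUnion hκ (hRC _ Y hYc)
  have hlt : ∀ α ∈ Iic δ, ∀ y ∈ Y, α < y := fun α hα y hy =>
    lt_of_le_of_lt hα (not_le.1 (hY hy).2)
  -- A value `g y ∉ σ` would make the colour-`g y` neighbours of `y` in `T` positive at `δ < y`,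
  -- which the choice of `T` excludes.
  have hgσ : ∀ y : Y, g y ∈ σ := by
    intro y
    by_contra hy
    exact hTn _ hy δ hδT y (hY y.2).1 (hlt δ le_rfl y y.2)
      (hg.mono fun α hα => ⟨hα.1.1, hlt α hα.1.2 y y.2, hα.2 y⟩)
  classical
  have : Nonempty C := ⟨f ε ε⟩
  obtain ⟨i, hi, y, hy, hyh⟩ := hYr (fun z => if h : z ∈ Y then g ⟨z, h⟩ else Classical.arbitrary C)
    fun z hz => by simpa [hz] using hgσ ⟨z, hz⟩
  obtain ⟨x, hx, hxh⟩ := hg.exists_homogeneousSeq hκ.aleph0_le hi hK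
  refine ⟨i, x, y, hxh, hyh, fun ν η => ⟨hlt _ (hx ν).1.2 _ (hy η).1, ?_⟩⟩
  have h := (hy η).2
  rw [dif_pos (hy η).1] at h
  exact ((hx ν).2 ⟨y η, (hy η).1⟩).trans h

end Core

/-! ### Cardinals below `log κ`, and the order type of the union. -/

section CardLog

variable {κ : Cardinal.{u}}

theorem two_power_lt_of_lt_cardLog {c : Cardinal.{u}} (hc : c < cardLog κ) : 2 ^ c < κ :=
  not_le.1 fun h => hc.not_ge ((isLeast_cardLog κ).2 h)

theorem aleph0_le_cardLog (hκ : ℵ₀ ≤ κ) : ℵ₀ ≤ cardLog κ := by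
  by_contra! h
  exact (hκ.trans (isLeast_cardLog κ).1).not_gt (power_lt_aleph0 (by simp) h)

theorem pow_lt_cardLog (hκ : ℵ₀ ≤ κ) {c : Cardinal.{u}} (hc : c < cardLog κ) (n : ℕ) :
    c ^ n < cardLog κ := by
  induction n with
  | zero => simpa using one_lt_aleph0.trans_le (aleph0_le_cardLog hκ)
  | succ n ih => exact pow_succ c n ▸ mul_lt_of_lt (aleph0_le_cardLog hκ) ih hc

theorem natCast_power_lt_of_lt_cardLog (hκ : ℵ₀ ≤ κ) {c : Cardinal.{u}} (hc : c < cardLog κ)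
    (k : ℕ) : (k : Cardinal.{u}) ^ c < κ := by
  calc (k : Cardinal.{u}) ^ c ≤ (2 ^ (k : Cardinal.{u})) ^ c :=
        power_le_power_right (cantor _).le
    _ = 2 ^ ((k : Cardinal.{u}) * c) := power_mul.symm
    _ < κ := two_power_lt_of_lt_cardLog
      (mul_lt_of_lt (aleph0_le_cardLog hκ) (natCast_lt_aleph0.trans_le (aleph0_le_cardLog hκ)) hc)

end CardLog

theorem type_range_of_sumLex {L K R : Type u} [LinearOrder L] [WellFoundedLT L] [LinearOrder K]
    [WellFoundedLT K] [LinearOrder R] [WellFoundedLT R] {h : K ⊕ R → L}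
    (hh : ∀ a b, Sum.Lex (· < ·) (· < ·) a b → h a < h b) :
    Ordinal.type (fun a b : range h => a < b) =
      Ordinal.type (α := K) (· < ·) + Ordinal.type (α := R) (· < ·) := by
  rw [← Ordinal.type_sum_lex, eq_comm, Ordinal.type_eq]
  let e : Sum.Lex (α := K) (β := R) (· < ·) (· < ·) ↪r ((· < ·) : L → L → Prop) :=
    RelEmbedding.ofMonotone h hh
  refine ⟨⟨Equiv.ofInjective h e.injective, fun {a b} => e.map_rel_iff⟩⟩

end ErdosRado

open ErdosRado in
theorem theorem3p1 (κ : Cardinal.{u}) (hreg : κ.IsRegular) (hunc : Cardinal.aleph0 < κ)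
    (k : ℕ) (ξ : Ordinal.{u}) (hξ : ξ < (ErdosRado.cardLog κ).ord) :
    ErdosRado.PartitionRel (Order.succ (Cardinal.powerlt 2 κ)).ord (κ.ord + ξ) (Fin k) := by
  classical
  intro f
  have hinf : Cardinal.aleph0 ≤ Cardinal.powerlt 2 κ := hunc.le.trans (le_two_powerlt κ)
  have hb : ∀ s : Set (Order.succ (Cardinal.powerlt 2 κ)).ord.ToType,
      Cardinal.mk s ≤ Cardinal.powerlt 2 κ → ∃ b, ∀ x ∈ s, x < b := fun s hs =>
    exists_forall_lt_of_mk_lt (Cardinal.isRegular_succ hinf) s (Order.lt_succ_iff.2 hs)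
  obtain ⟨a₀, -⟩ := hb ∅ (by simp)
  obtain ⟨b₀, hab⟩ := hb {a₀} (by simpa using Cardinal.one_le_aleph0.trans hinf)
  have : Nonempty (Fin k) := ⟨f ⟨{a₀, b₀}, by simp [Finset.card_pair (hab _ rfl).ne]⟩⟩
  have hr : ξ.card < cardLog κ := Cardinal.lt_ord.1 hξ
  obtain ⟨i, x, y, hx, hy, hxy⟩ := exists_homogeneousSeq_pair hreg hb
    (fun b => Order.lt_succ_iff.1 (mk_Iio_ord_toType_lt b))
    (K := κ.ord.ToType) (R := ξ.ToType) mk_Iio_ord_toType_lt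
    (fun n => (Cardinal.cantor _).trans
      (two_power_lt_of_lt_cardLog (pow_lt_cardLog hunc.le (by simpa using hr) n)))
    (fun n Y hY => by
      simpa using natCast_power_lt_of_lt_cardLog hunc.le
        (hY.trans_lt (pow_lt_cardLog hunc.le (by simpa using hr) n)) k)
    -- The diagonal value is arbitrary: only pairs of distinct points are used in the conclusion.
    (fun a b => if h : a ≠ b then f ⟨{a, b}, by simp [Finset.card_pair h]⟩
      else Classical.arbitrary (Fin k))
  have hsum : ∀ a b, Sum.Lex (· < ·) (· < ·) a b → Sum.elim x y a < Sum.elim x y b ∧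
      (if h : Sum.elim x y a ≠ Sum.elim x y b then
        f ⟨{Sum.elim x y a, Sum.elim x y b}, by simp [Finset.card_pair h]⟩
        else Classical.arbitrary (Fin k)) = i := by
    rintro _ _ (⟨h⟩ | ⟨h⟩ | _)
    exacts [hx _ _ h, hy _ _ h, hxy _ _]
  have hcol : ∀ p : Set.powersetCard (Order.succ (Cardinal.powerlt 2 κ)).ord.ToType 2,
      ((p.1 : Finset _) : Set (Order.succ (Cardinal.powerlt 2 κ)).ord.ToType) ⊆ Set.range (Sum.elim x y) → f p = i := by
    rintro ⟨p, hp⟩ hpX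
    obtain ⟨a, b, hne, rfl⟩ := Finset.card_eq_two.1 hp
    obtain ⟨s, rfl⟩ := hpX (by simp : a ∈ _)
    obtain ⟨t, rfl⟩ := hpX (by simp : b ∈ _)
    rcases trichotomous_of (Sum.Lex (· < ·) (· < ·)) s t with h | rfl | h
    · have := (hsum _ _ h).2
      rwa [dif_pos hne] at this
    · exact (hne rfl).elim
    · have := (hsum _ _ h).2
      rw [dif_pos hne.symm] at this
      rw [← this]
      congr 2
      exact Finset.pair_comm _ _
  refine ⟨Set.range (Sum.elim x y), ?_, fun p q hp hq => (hcol p hp).trans (hcol q hq).symm⟩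
  rw [type_range_of_sumLex fun a b h => (hsum a b h).1]
  simp
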